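/- Let $p$ be a prime and $q=p^d$ with $d\ge 1$. All groups below are profinite, subgroups are closed and homomorphisms are continuous; $H^n(\Gamma)=H^n(\Gamma,\mathbb{Z}/q)$ denotes continuous cohomology with trivial action. For a profinite group $\Gamma$ and a normal subgroup $N$, let $N^q[N,\Gamma]$ be the closed subgroup topologically generated by all $n^q$ and all $[n,g]=n^{-1}g^{-1}ng$ with $n\in N$, $g\in\Gamma$. The descending $q$-central sequence of $\Gamma$ is $\Gamma^{(1)}=\Gamma$, $\Gamma^{(i+1)}=(\Gamma^{(i)})^q[\Gamma^{(i)},\Gamma]$, and $\Gamma^{[i]}=\Gamma/\Gamma^{(i)}$. The group $H^1(N)^\Gamma$ consists of the continuous homomorphisms $\varphi\colon N\to\mathbb{Z}/q$ with $\varphi(g^{-1}ng)=\varphi(n)$ for all $g\in\Gamma$, $n\in N$. Let $G$ be a profinite group with maximal pro-$p$ quotient $G(p)$, let $S$ be a free pro-$p$ group (of possibly infinite rank), and let $\pi\colon S\to G(p)$ be an epimorphism with kernel $R$. Let $T$ be the kernel of the composition $S\xrightarrow{\pi}G(p)\to G^{[2]}$, and let $f$ be the composition $$H^1(T)^S\xrightarrow{\mathrm{trg}}H^2(G^{[2]})\xrightarrow{\inf}H^2(G(p))\xrightarrow{\inf}H^2(G),$$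 where $\mathrm{trg}$ is the transgression for $1\to T\to S\to G^{[2]}\to 1$ and the other maps are inflations. Let $\mathrm{Ker}(f)^\vee$ be the annihilator of $\mathrm{Ker}(f)$ in $T/T^q[T,S]$ under the pairing $$T/T^q[T,S]\times H^1(T)^S\to\mathbb{Z}/q,\qquad(\bar t,\varphi)\mapsto\varphi(t).$$ **Proposition 7.3.** Suppose that the presentation $1\to R\to S\xrightarrow{\pi}G(p)\to1$ is minimal, i.e. $R\le S^{(2)}$. Then $T=S^{(2)}$, so that $T/T^q[T,S]=S^{(2)}/S^{(3)}$ is a subgroup of $S^{[3]}$, and there is an isomorphism of profinite groups $$G^{[3]}\cong S^{[3]}/\mathrm{Ker}(f)^\vee.$$ -/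

import Mathlib

open CategoryTheory

set_option linter.unusedSectionVars false

universe u

noncomputable section

/-! ### The descending `q`-central sequence -/

section DescendingCentral

variable {G : Type u} [Group G] [TopologicalSpace G] [IsTopologicalGroup G]

/-- `N^q[N,G]`: the closed subgroup of `G` topologically generated by all `n ^ q` and all
commutators `[n,g] = n⁻¹ g⁻¹ n g`, where `n ∈ N` and `g ∈ G`. -/
def qCommutator (q : ℕ) (N : Subgroup G) : Subgroup G :=
  (Subgroup.closure ({x | ∃ n ∈ N, x = n ^ q} ∪
    {x | ∃ n ∈ N, ∃ g : G, x = n⁻¹ * g⁻¹ * n * g})).topologicalClosure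

lemma pow_mem_qCommutator (q : ℕ) (N : Subgroup G) {n : G} (hn : n ∈ N) :
    n ^ q ∈ qCommutator q N :=
  Subgroup.le_topologicalClosure _ (Subgroup.subset_closure (Or.inl ⟨n, hn, rfl⟩))

lemma comm_mem_qCommutator (q : ℕ) (N : Subgroup G) {n : G} (hn : n ∈ N) (g : G) :
    n⁻¹ * g⁻¹ * n * g ∈ qCommutator q N :=
  Subgroup.le_topologicalClosure _ (Subgroup.subset_closure (Or.inr ⟨n, hn, g, rfl⟩))

instance qCommutator_normal (q : ℕ) (N : Subgroup G) [hN : N.Normal] :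
    (qCommutator q N).Normal := by
  have : (Subgroup.closure ({x | ∃ n ∈ N, x = n ^ q} ∪
      {x : G | ∃ n ∈ N, ∃ g : G, x = n⁻¹ * g⁻¹ * n * g})).Normal := by
    refine ⟨fun x hx h => ?_⟩
    induction hx using Subgroup.closure_induction with
    | mem x hx =>
      apply Subgroup.subset_closure
      rcases hx with ⟨n, hn, rfl⟩ | ⟨n, hn, g, rfl⟩
      · exact Or.inl ⟨h * n * h⁻¹, hN.conj_mem n hn h, by rw [conj_pow]⟩
      · exact Or.inr ⟨h * n * h⁻¹, hN.conj_mem n hn h, h * g * h⁻¹, by group⟩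
    | one => simp [one_mem]
    | mul x y _ _ hx hy =>
      have e : h * (x * y) * h⁻¹ = (h * x * h⁻¹) * (h * y * h⁻¹) := by group
      rw [e]
      exact mul_mem hx hy
    | inv x _ hx =>
      have e : h * x⁻¹ * h⁻¹ = (h * x * h⁻¹)⁻¹ := by group
      rw [e]
      exact inv_mem hx
  exact Subgroup.is_normal_topologicalClosure _

lemma isClosed_qCommutator (q : ℕ) (N : Subgroup G) : IsClosed (qCommutator q N : Set G) :=
  Subgroup.isClosed_topologicalClosure _

/-- The descending `q`-central sequence `G^(1) = G`, `G^(i+1) = (G^(i))^q [G^(i), G]`.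
The index `0` is not used by the sequence and gets the value `G`. -/
def qCentral (q : ℕ) (G : Type u) [Group G] [TopologicalSpace G] [IsTopologicalGroup G] :
    ℕ → Subgroup G
  | 0 => ⊤
  | 1 => ⊤
  | i + 2 => qCommutator q (qCentral q G (i + 1))

instance qCentral_normal (q : ℕ) : ∀ i, (qCentral q G i).Normal
  | 0 => by rw [qCentral]; infer_instance
  | 1 => by rw [qCentral]; infer_instance
  | i + 2 => by
      have := qCentral_normal q (i + 1)
      rw [qCentral]; infer_instance

lemma isClosed_qCentral (q : ℕ) : ∀ i, IsClosed (qCentral q G i : Set G)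
  | 0 => by rw [qCentral]; exact isClosed_univ
  | 1 => by rw [qCentral]; exact isClosed_univ
  | i + 2 => by rw [qCentral]; exact isClosed_qCommutator _ _

/-- `G^[i] = G / G^(i)`. -/
abbrev qCentralQuotient (q : ℕ) (G : Type u) [Group G] [TopologicalSpace G]
    [IsTopologicalGroup G] (i : ℕ) : Type u :=
  G ⧸ qCentral q G i

instance qCentralQuotient_t2 (q : ℕ) (i : ℕ) : T2Space (qCentralQuotient q G i) :=
  haveI := isClosed_qCentral (G := G) q i
  QuotientGroup.instT2Space

end DescendingCentral

/-! ### Pro-`p` groups -/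

section ProP

/-- A profinite group is pro-`p` if all its open normal subgroups have `p`-power index. -/
def IsProP (p : ℕ) (G : Type u) [Group G] [TopologicalSpace G] : Prop :=
  ∀ U : Subgroup G, U.Normal → IsOpen (U : Set G) → ∃ k : ℕ, U.index = p ^ k

/-- A pro-`p` group `S` is free pro-`p` if it has a basis `B`: a subset of `S` converging to `1`
such that every map from `B` to a pro-`p` group `H` which converges to `1` extends uniquely to a
continuous homomorphism from `S` to `H`. The basis may be infinite. -/
def IsFreeProP (p : ℕ) (S : Type u) [Group S] [TopologicalSpace S] : Prop :=
  IsProP p S ∧ ∃ B : Set S,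
    (∀ U : Subgroup S, U.Normal → IsOpen (U : Set S) → (B \ (U : Set S)).Finite) ∧
    ∀ H : ProfiniteGrp.{u}, IsProP p H → ∀ f : B → H,
      (∀ U : Subgroup H, U.Normal → IsOpen (U : Set H) → {b | f b ∉ U}.Finite) →
        ∃! F : S →ₜ* H, ∀ b : B, F b = f b

variable (p : ℕ) (G : Type u) [Group G] [TopologicalSpace G]

/-- The kernel of `G → G(p)`: the intersection of all open normal subgroups of `p`-power index. -/
def proPKernel : Subgroup G :=
  sInf {U : Subgroup G | U.Normal ∧ IsOpen (U : Set G) ∧ ∃ k : ℕ, U.index = p ^ k}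

instance proPKernel_normal : (proPKernel p G).Normal :=
  ⟨fun n hn g => Subgroup.mem_sInf.2 fun U hU =>
    hU.1.conj_mem n (Subgroup.mem_sInf.1 hn U hU) g⟩

/-- The maximal pro-`p` quotient `G(p)` of `G`. -/
abbrev MaxProP : Type u := G ⧸ proPKernel p G

variable [IsTopologicalGroup G] [CompactSpace G] [TotallyDisconnectedSpace G]

lemma proPKernel_le [Fact p.Prime] (d : ℕ) : proPKernel p G ≤ qCentral (p ^ d) G 2 := by
  intro x hx
  by_contra hxC
  have hpow : ∀ g : G, g ^ (p ^ d) ∈ qCentral (p ^ d) G 2 := fun g =>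
    pow_mem_qCommutator (p ^ d) _ (Subgroup.mem_top g)
  have hopen : IsOpen {u : G | x * u ∉ qCentral (p ^ d) G 2} :=
    ((isClosed_qCentral (G := G) (p ^ d) 2).preimage (continuous_const_mul x)).isOpen_compl
  obtain ⟨U, hU⟩ := ProfiniteGrp.exist_openNormalSubgroup_sub_open_nhds_of_one hopen
    (by simpa using hxC)
  have hV : IsOpen ((U.toSubgroup ⊔ qCentral (p ^ d) G 2 : Subgroup G) : Set G) :=
    Subgroup.isOpen_mono le_sup_left U.isOpen'
  have hfin := Subgroup.quotient_finite_of_isOpen _ hV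
  have hpg : IsPGroup p (G ⧸ (U.toSubgroup ⊔ qCentral (p ^ d) G 2 : Subgroup G)) := by
    intro y
    obtain ⟨g, rfl⟩ := QuotientGroup.mk_surjective y
    refine ⟨d, ?_⟩
    rw [← QuotientGroup.mk_pow]
    exact (QuotientGroup.eq_one_iff _).2 ((le_sup_right : qCentral (p ^ d) G 2 ≤ _) (hpow g))
  have hxV := Subgroup.mem_sInf.1 hx _ ⟨inferInstance, hV, IsPGroup.iff_card.1 hpg⟩
  obtain ⟨u, hu, c, hc, rfl⟩ := Subgroup.mem_sup_of_normal_left.1 hxV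
  refine hU (U.isNormal'.conj_mem _ (inv_mem hu) (u * c)⁻¹ : _ ∈ U.toSubgroup) ?_
  have e : u * c * ((u * c)⁻¹ * u⁻¹ * (u * c)⁻¹⁻¹) = c := by group
  rw [e]
  exact hc

end ProP

section QuotientMaps

variable {G : Type u} [Group G] [TopologicalSpace G] [IsTopologicalGroup G]

/-- The projection `G → G / N`. -/
def quotientProj (N : Subgroup G) [N.Normal] : G →ₜ* G ⧸ N where
  toMonoidHom := QuotientGroup.mk' N
  continuous_toFun := QuotientGroup.continuous_mk

/-- The projection `G / M → G / N` for `M ≤ N`. -/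
def quotientMapOfLE (M N : Subgroup G) [M.Normal] [N.Normal] (h : M ≤ N) : G ⧸ M →ₜ* G ⧸ N where
  toMonoidHom := QuotientGroup.map M N (MonoidHom.id G) h
  continuous_toFun := (QuotientGroup.continuous_mk (N := N)).quotient_lift _

/-- The natural map `G(p) → G^[2]`, where `q = p ^ d`. -/
def maxProPToTwo (p : ℕ) [Fact p.Prime] (d : ℕ) (G : Type u) [Group G] [TopologicalSpace G]
    [IsTopologicalGroup G] [CompactSpace G] [TotallyDisconnectedSpace G] :
    MaxProP p G →ₜ* qCentralQuotient (p ^ d) G 2 :=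
  quotientMapOfLE _ _ (proPKernel_le p G d)

lemma maxProPToTwo_surjective (p : ℕ) [Fact p.Prime] (d : ℕ) (G : Type u) [Group G]
    [TopologicalSpace G] [IsTopologicalGroup G] [CompactSpace G] [TotallyDisconnectedSpace G] :
    Function.Surjective (maxProPToTwo p d G) := by
  intro x
  obtain ⟨g, rfl⟩ := QuotientGroup.mk_surjective x
  exact ⟨(g : MaxProP p G), rfl⟩

end QuotientMaps

/-! ### Continuous cohomology with coefficients in the trivial module `ℤ/q` -/

section Cohomology

instance instContinuousSMulULiftZMod (q : ℕ) : ContinuousSMul (ZMod q) (ULift.{u} (ZMod q)) :=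
  ⟨continuous_of_discreteTopology⟩

/-- The discrete trivial `G`-module `ℤ/q` (lifted to the universe of `G`). -/
abbrev trivialCoeff (q : ℕ) (G : Type u) [Group G] [TopologicalSpace G] [IsTopologicalGroup G] :
    TopRep.{u} (ZMod q) G :=
  TopRep.of (ContRepresentation.trivial (ZMod q) G (ULift.{u} (ZMod q)))

/-- The complex of homogeneous continuous cochains of `G` with values in `ℤ/q`. -/
abbrev cochains (q : ℕ) (G : Type u) [Group G] [TopologicalSpace G] [IsTopologicalGroup G] :
    CochainComplex (TopModuleCat (ZMod q)) ℕ :=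
  TopRep.homogeneousCochains (trivialCoeff q G)

/-- `Hⁿ(G) = Hⁿ(G, ℤ/q)`. -/
abbrev cohomologyZMod (q n : ℕ) (G : Type u) [Group G] [TopologicalSpace G]
    [IsTopologicalGroup G] : TopModuleCat (ZMod q) :=
  continuousCohomology n (trivialCoeff q G)

variable {S Q : Type u} [Group S] [TopologicalSpace S] [IsTopologicalGroup S]
  [Group Q] [TopologicalSpace Q] [IsTopologicalGroup Q]

/-- The identity of `ℤ/q`, as a map of trivial `S`-modules. -/
def coeffMap (q : ℕ) (ρ : S →ₜ* Q) :
    TopRep.res (ρ : S →* Q) (trivialCoeff q Q) ⟶ trivialCoeff q S :=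
  𝟙 (trivialCoeff q S)

/-- The pullback of homogeneous cochains along `ρ : S → Q`. -/
def cochainsPullback (q : ℕ) (ρ : S →ₜ* Q) : cochains q Q ⟶ cochains q S :=
  ContinuousCohomology.cochainsMap ρ (coeffMap q ρ)

/-- The map `Hⁿ(Q) → Hⁿ(S)` induced by `ρ : S → Q`; the inflation, if `ρ` is surjective. -/
def inflation (q n : ℕ) (ρ : S →ₜ* Q) : cohomologyZMod q n Q →+ cohomologyZMod q n S :=
  (ContinuousCohomology.map ρ (coeffMap q ρ) n).hom.toLinearMap.toAddMonoidHom

/-- `H¹(N)^S` for a normal subgroup `N` of `S`: the continuous homomorphisms `φ : N → ℤ/q` with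
`φ (s⁻¹ n s) = φ n` for all `s ∈ S`, `n ∈ N`. -/
def invariantHoms (q : ℕ) (N : Subgroup S) [N.Normal] : AddSubgroup C(N, ZMod q) where
  carrier := {φ | (∀ m n : N, φ (m * n) = φ m + φ n) ∧
    ∀ (s : S) (n : N), φ (MulAut.conjNormal s⁻¹ n) = φ n}
  add_mem' := by
    rintro φ ψ ⟨h1, h2⟩ ⟨h3, h4⟩
    refine ⟨fun m n => ?_, fun s n => ?_⟩
    · simp only [ContinuousMap.add_apply, h1, h3]; abel
    · simp only [ContinuousMap.add_apply, h2, h4]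
  zero_mem' := by simp
  neg_mem' := by
    rintro φ ⟨h1, h2⟩
    refine ⟨fun m n => ?_, fun s n => ?_⟩
    · simp only [ContinuousMap.neg_apply, h1]; abel
    · simp only [ContinuousMap.neg_apply, h2]

/-- The defining relation of the transgression for `ρ : S → Q` with kernel `N`: the `1`-cochain `a`
of `S` restricts to `φ` on `N`, and its coboundary is the inflation of the `2`-cocycle `z` of `Q`.
Then the transgression of `φ` is the class of `z`. -/
structure IsTransgressionPair (q : ℕ) (ρ : S →ₜ* Q) (φ : C(ρ.toMonoidHom.ker, ZMod q))
    (a : (cochains q S).X 1) (z : ContinuousCohomology.cocycles (trivialCoeff q Q) 2) : Prop where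
  restrict : ∀ n : ρ.toMonoidHom.ker, a.1 1 (n : S) = ULift.up (φ n)
  coboundary : ((cochains q S).d 1 2).hom a =
    ((cochainsPullback q ρ).f 2).hom (((cochains q Q).iCycles 2).hom z)

end Cohomology

section Transgression

variable {S Q : Type u} [Group S] [TopologicalSpace S] [IsTopologicalGroup S]
  [Group Q] [TopologicalSpace Q] [IsTopologicalGroup Q] (q : ℕ)

lemma d_one_two_apply (a : (cochains q S).X 1) (x y z : S) :
    (((cochains q S).d 1 2).hom a).1 x y z = a.1 y z - (a.1 x z - a.1 x y) := by
  rw [TopRep.homogeneousCochains.d_apply]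
  rfl

lemma d_two_three_apply (a : (cochains q S).X 2) (x y z w : S) :
    (((cochains q S).d 2 3).hom a).1 x y z w =
      a.1 y z w - (a.1 x z w - (a.1 x y w - a.1 x y z)) := by
  rw [TopRep.homogeneousCochains.d_apply]
  rfl

lemma cochainsPullback_one_apply (ρ : S →ₜ* Q) (a : (cochains q Q).X 1) (x y : S) :
    (((cochainsPullback q ρ).f 1).hom a).1 x y = a.1 (ρ x) (ρ y) := rfl

lemma cochainsPullback_two_apply (ρ : S →ₜ* Q) (a : (cochains q Q).X 2) (x y z : S) :
    (((cochainsPullback q ρ).f 2).hom a).1 x y z = a.1 (ρ x) (ρ y) (ρ z) := rfl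

lemma cochain_one_ext {a b : (cochains q S).X 1} (h : ∀ x y, a.1 x y = b.1 x y) : a = b :=
  Subtype.ext (ContinuousMap.ext fun x => ContinuousMap.ext fun y => h x y)

lemma cochain_two_ext {a b : (cochains q S).X 2} (h : ∀ x y z, a.1 x y z = b.1 x y z) : a = b :=
  Subtype.ext (ContinuousMap.ext fun x => ContinuousMap.ext fun y => ContinuousMap.ext fun z =>
    h x y z)

lemma cochain_three_ext {a b : (cochains q S).X 3}
    (h : ∀ x y z w, a.1 x y z w = b.1 x y z w) : a = b :=
  Subtype.ext (ContinuousMap.ext fun x => ContinuousMap.ext fun y => ContinuousMap.ext fun z =>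
    ContinuousMap.ext fun w => h x y z w)

lemma cochain_one_inv (a : (cochains q S).X 1) (g x y : S) :
    a.1 (g * x) (g * y) = a.1 x y := by
  have := congrArg (fun f => f (g * x) (g * y)) (a.2 g)
  simpa using this.symm

lemma exists_cochain_one (F : C(S × S, ZMod q))
    (hF : ∀ g x y, F (g * x, g * y) = F (x, y)) :
    ∃ a : (cochains q S).X 1, ∀ x y, a.1 x y = ULift.up (F (x, y)) := by
  let F' : C(S × S, ULift.{u} (ZMod q)) := ⟨fun x => ULift.up (F x), by fun_prop⟩
  refine ⟨⟨F'.curry, fun g => ?_⟩, fun x y => rfl⟩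
  ext x y
  exact hF g⁻¹ x y

lemma exists_cochain_two (F : C((S × S) × S, ZMod q))
    (hF : ∀ g x y z, F ((g * x, g * y), g * z) = F ((x, y), z)) :
    ∃ a : (cochains q S).X 2, ∀ x y z, a.1 x y z = ULift.up (F ((x, y), z)) := by
  let F' : C((S × S) × S, ULift.{u} (ZMod q)) := ⟨fun x => ULift.up (F x), by fun_prop⟩
  refine ⟨⟨F'.curry.curry, fun g => ?_⟩, fun x y z => rfl⟩
  ext x y z
  exact hF g⁻¹ x y z

lemma exists_cocycle_two (a : (cochains q Q).X 2) (ha : ((cochains q Q).d 2 3).hom a = 0) :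
    ∃ z : ContinuousCohomology.cocycles (trivialCoeff q Q) 2,
      ((cochains q Q).iCycles 2).hom z = a := by
  let K := cochains q Q
  let l := K.liftCycles (TopModuleCat.kerι (K.d 2 3)) 3 (by simp)
    (TopModuleCat.kerι_comp (K.d 2 3))
  refine ⟨l.hom ⟨a, ha⟩, ?_⟩
  have := K.liftCycles_i (TopModuleCat.kerι (K.d 2 3)) 3 (by simp)
    (TopModuleCat.kerι_comp (K.d 2 3))
  exact congrArg (fun f => f.hom ⟨a, ha⟩) this

lemma iCycles_injective : Function.Injective ((cochains q Q).iCycles 2).hom := by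
  let K := cochains q Q
  let l := K.liftCycles (TopModuleCat.kerι (K.d 2 3)) 3 (by simp)
    (TopModuleCat.kerι_comp (K.d 2 3))
  let e : K.cycles 2 ⟶ TopModuleCat.ker (K.d 2 3) :=
    (TopModuleCat.isLimitKer (K.d 2 3)).lift (Limits.KernelFork.ofι (K.iCycles 2) (by simp))
  have he : e ≫ TopModuleCat.kerι (K.d 2 3) = K.iCycles 2 :=
    (TopModuleCat.isLimitKer (K.d 2 3)).fac _ Limits.WalkingParallelPair.zero
  have hl : l ≫ K.iCycles 2 = TopModuleCat.kerι (K.d 2 3) := by simp [l]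
  have hel : e ≫ l = 𝟙 _ := by
    rw [← cancel_mono (K.iCycles 2), Category.assoc, hl, he, Category.id_comp]
  intro x y hxy
  have hx : ∀ w, ((e.hom w).1) = (K.iCycles 2).hom w := fun w => congrArg (fun f => f.hom w) he
  have h1 : e.hom x = e.hom y := Subtype.ext (by rw [hx, hx]; exact hxy)
  have h2 : ∀ w, l.hom (e.hom w) = w := fun w => congrArg (fun f => f.hom w) hel
  rw [← h2 x, ← h2 y, h1]

lemma class_eq_zero (z : ContinuousCohomology.cocycles (trivialCoeff q Q) 2)
    (b : (cochains q Q).X 1)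
    (h : ((cochains q Q).d 1 2).hom b = ((cochains q Q).iCycles 2).hom z) :
    (ContinuousCohomology.π (trivialCoeff q Q) 2).hom z = 0 := by
  let K := cochains q Q
  have h1 : (K.toCycles 1 2).hom b = z := by
    apply iCycles_injective
    rw [← h]
    exact congrArg (fun f => f.hom b) (K.toCycles_i 1 2)
  have h2 : K.toCycles 1 2 ≫ K.homologyπ 2 = 0 := K.toCycles_comp_homologyπ 1 2
  rw [← h1]
  exact congrArg (fun f => f.hom b) h2

/-- An invariant homomorphism on the kernel extends to a continuous `1`-cochain `c` with
`c (s n) = c s + φ n`. -/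
lemma exists_extension [CompactSpace S] [TotallyDisconnectedSpace S] (N : Subgroup S) [N.Normal]
    (φ : invariantHoms q N) :
    ∃ c : C(S, ZMod q), (∀ n : N, c n = φ.1 n) ∧ ∀ (s : S) (n : N), c (s * n) = c s + φ.1 n := by
  obtain ⟨φ, hφ, -⟩ := φ
  dsimp only
  have h1 : φ 1 = 0 := by simpa using hφ 1 1
  have hinv : ∀ n : N, φ n⁻¹ = - φ n := fun n => by
    have := hφ n⁻¹ n
    rw [inv_mul_cancel, h1] at this
    exact eq_neg_of_add_eq_zero_left this.symm
  obtain ⟨W, hW, hWφ⟩ := isOpen_induced_iff.1 ((isOpen_discrete {(0 : ZMod q)}).preimage φ.2)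
  obtain ⟨U, hU⟩ := ProfiniteGrp.exist_openNormalSubgroup_sub_open_nhds_of_one hW
    (show (1 : S) ∈ W by
      have : (1 : N) ∈ ((fun n : N => (n : S)) ⁻¹' W) := by
        change (1 : N) ∈ (Subtype.val ⁻¹' W)
        rw [hWφ]; exact h1
      exact this)
  have hUφ : ∀ n : N, (n : S) ∈ U.toSubgroup → φ n = 0 := fun n hn => by
    have : n ∈ (Subtype.val ⁻¹' W : Set N) := hU hn
    rw [hWφ] at this
    exact this
  have huniq : ∀ u ∈ U.toSubgroup, ∀ u' ∈ U.toSubgroup, ∀ n n' : N,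
      u * n = u' * n' → φ n = φ n' := by
    intro u hu u' hu' n n' h
    have h2 : (n : S) * (n' : S)⁻¹ = u⁻¹ * u' := by
      rw [eq_inv_mul_iff_mul_eq, ← mul_assoc, h, mul_assoc, mul_inv_cancel, mul_one]
    have h3 := hUφ (n * n'⁻¹) (by
      push_cast
      rw [h2]; exact mul_mem (inv_mem hu) hu')
    rw [hφ, hinv] at h3
    exact add_neg_eq_zero.1 h3
  have hdec : ∀ s : S, ∃ n : N, ∃ u ∈ U.toSubgroup,
      (Quotient.out (s : S ⧸ (U.toSubgroup ⊔ N)))⁻¹ * s = u * n := fun s => by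
    have : (Quotient.out (s : S ⧸ (U.toSubgroup ⊔ N)))⁻¹ * s ∈ U.toSubgroup ⊔ N :=
      QuotientGroup.eq.1 (Quotient.out_eq' (s : S ⧸ (U.toSubgroup ⊔ N)))
    obtain ⟨u, hu, n, hn, h⟩ := Subgroup.mem_sup_of_normal_left.1 this
    exact ⟨⟨n, hn⟩, u, hu, h.symm⟩
  choose ν υ hυ hυν using hdec
  have hkey : ∀ s t : S, t ∈ U.toSubgroup ⊔ N →
      ((s * t : S) : S ⧸ (U.toSubgroup ⊔ N)) = s := fun s t ht =>
    (QuotientGroup.mk_mul_of_mem s ht)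
  have hadd : ∀ (s : S) (n : N), φ (ν (s * n)) = φ (ν s) + φ n := fun s n => by
    rw [← hφ]
    refine huniq (υ (s * n)) (hυ _) (υ s) (hυ s) _ _ ?_
    rw [← hυν (s * n), hkey s n ((le_sup_right : N ≤ _) n.2), ← mul_assoc, hυν s]
    push_cast
    rw [mul_assoc]
  have hloc : ∀ s : S, ∀ v ∈ U.toSubgroup, φ (ν (s * v)) = φ (ν s) := fun s v hv => by
    refine huniq (υ (s * v)) (hυ _) (υ s * (ν s * v * (ν s)⁻¹))
      (mul_mem (hυ s) (U.isNormal'.conj_mem v hv _)) _ _ ?_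
    rw [← hυν (s * v), hkey s v ((le_sup_left : U.toSubgroup ≤ _) hv), ← mul_assoc, hυν s]
    simp [mul_assoc]
  have hcont : Continuous fun s => φ (ν s) := by
    refine IsLocallyConstant.continuous ((IsLocallyConstant.iff_exists_open _).2 fun s => ?_)
    refine ⟨(fun t => s⁻¹ * t) ⁻¹' (U.toSubgroup : Set S),
      U.isOpen'.preimage (continuous_const_mul s⁻¹), ?_, fun t ht => ?_⟩
    · simp [one_mem]
    · have := hloc s (s⁻¹ * t) ht
      rwa [mul_inv_cancel_left] at this
  refine ⟨⟨fun s => φ (ν s) - φ (ν 1), hcont.sub continuous_const⟩, fun n => ?_, fun s n => ?_⟩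
  · have := hadd 1 n
    rw [one_mul] at this
    simp [this]
  · simp only [ContinuousMap.coe_mk, hadd]
    abel

lemma exists_isTransgressionPair [CompactSpace S] [TotallyDisconnectedSpace S] [T2Space Q]
    (ρ : S →ₜ* Q) (hρ : Function.Surjective ρ) (φ : invariantHoms q ρ.toMonoidHom.ker) :
    ∃ a z, IsTransgressionPair q ρ φ.1 a z := by
  obtain ⟨c, hc1, hc⟩ := exists_extension q ρ.toMonoidHom.ker φ
  obtain ⟨σ, hσ⟩ := hρ.hasRightInverse
  -- the coboundary of `c` only depends on the images in `Q`
  have hright : ∀ x y n : S, ρ n = 1 → c (y * n) - c (x * (y * n)) + c x =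
      c y - c (x * y) + c x := fun x y n hn => by
    rw [← mul_assoc, hc y ⟨n, hn⟩, hc (x * y) ⟨n, hn⟩]
    abel
  have hleft : ∀ x y n : S, ρ n = 1 → c y - c (x * n * y) + c (x * n) =
      c y - c (x * y) + c x := fun x y n hn => by
    have h1 := hc (x * y) (MulAut.conjNormal y⁻¹ (⟨n, hn⟩ : ρ.toMonoidHom.ker))
    rw [φ.2.2, MulAut.conjNormal_apply] at h1
    have h2 : x * y * (y⁻¹ * (⟨n, hn⟩ : ρ.toMonoidHom.ker) * y⁻¹⁻¹) = x * n * y := by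
      group
    rw [h2] at h1
    rw [h1, hc x ⟨n, hn⟩]
    abel
  have hker : ∀ x y : S, ρ x = ρ y → ρ (x⁻¹ * y) = 1 := fun x y h => by
    rw [map_mul, map_inv, h, inv_mul_cancel]
  have hdep : ∀ x y x' y' : S, ρ x = ρ x' → ρ y = ρ y' →
      c y - c (x * y) + c x = c y' - c (x' * y') + c x' := fun x y x' y' hx hy => by
    have h1 := hleft x y (x⁻¹ * x') (hker x x' hx)
    have h2 := hright x' y (y⁻¹ * y') (hker y y' hy)
    rw [mul_inv_cancel_left] at h1 h2
    rw [h2, h1]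
  let ζ : Q × Q → ZMod q := fun x => c (σ x.2) - c (σ x.1 * σ x.2) + c (σ x.1)
  have hζ : ∀ x y : S, ζ (ρ x, ρ y) = c y - c (x * y) + c x := fun x y =>
    hdep _ _ _ _ (hσ _) (hσ _)
  have : T2Space S := inferInstance
  have hq : Topology.IsQuotientMap (Prod.map ρ ρ) :=
    ((map_continuous ρ).prodMap (map_continuous ρ)).isClosedMap.isQuotientMap
      ((map_continuous ρ).prodMap (map_continuous ρ)) (hρ.prodMap hρ)
  have hζc : Continuous ζ := by
    rw [hq.continuous_iff]
    have : ζ ∘ Prod.map ρ ρ = fun x => c x.2 - c (x.1 * x.2) + c x.1 := by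
      ext x
      exact hζ x.1 x.2
    rw [this]
    fun_prop
  obtain ⟨a, ha⟩ := exists_cochain_one q (S := S)
    ⟨fun x => c (x.1⁻¹ * x.2), by fun_prop⟩ (fun g x y => by
      simp [mul_assoc])
  obtain ⟨w, hw⟩ := exists_cochain_two q (S := Q)
    ⟨fun x => ζ (x.1.1⁻¹ * x.1.2, x.1.2⁻¹ * x.2), by fun_prop⟩ (fun g x y z => by
      simp [mul_assoc])
  have hwa : ((cochains q S).d 1 2).hom a = ((cochainsPullback q ρ).f 2).hom w := by
    apply cochain_two_ext
    intro x y z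
    rw [d_one_two_apply, cochainsPullback_two_apply, hw, ha, ha, ha]
    apply ULift.ext
    have := hζ (x⁻¹ * y) (y⁻¹ * z)
    simp only [map_mul, map_inv] at this
    simp only [ContinuousMap.coe_mk, this, ULift.sub_down]
    have e : x⁻¹ * y * (y⁻¹ * z) = x⁻¹ * z := by group
    rw [e]
    abel
  have hdw : ((cochains q Q).d 2 3).hom w = 0 := by
    have hdd : ((cochains q S).d 2 3).hom (((cochains q S).d 1 2).hom a) = 0 :=
      congrArg (fun f => f.hom a) ((cochains q S).d_comp_d 1 2 3)
    rw [hwa] at hdd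
    apply cochain_three_ext
    intro x y z t
    obtain ⟨x, rfl⟩ := hρ x
    obtain ⟨y, rfl⟩ := hρ y
    obtain ⟨z, rfl⟩ := hρ z
    obtain ⟨t, rfl⟩ := hρ t
    have := congrArg (fun f => f.1 x y z t) hdd
    dsimp only at this
    rw [d_two_three_apply] at this ⊢
    exact this
  obtain ⟨z, hz⟩ := exists_cocycle_two q w hdw
  refine ⟨a, z, fun n => ?_, ?_⟩
  · rw [ha]
    simp [hc1]
  · rw [hwa, hz]

lemma class_eq_zero_of_isTransgressionPair_zero [CompactSpace S] [TotallyDisconnectedSpace S]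
    [T2Space Q] (ρ : S →ₜ* Q) (hρ : Function.Surjective ρ)
    {a : (cochains q S).X 1} {z : ContinuousCohomology.cocycles (trivialCoeff q Q) 2}
    (h : IsTransgressionPair q ρ 0 a z) :
    (ContinuousCohomology.π (trivialCoeff q Q) 2).hom z = 0 := by
  obtain ⟨hres, hcob⟩ := h
  have hcob' : ∀ x y t : S, a.1 y t - (a.1 x t - a.1 x y) =
      (((cochains q Q).iCycles 2).hom z).1 (ρ x) (ρ y) (ρ t) := fun x y t => by
    rw [← d_one_two_apply, hcob]
    rfl
  obtain ⟨σ, hσ⟩ := hρ.hasRightInverse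
  have hc1 : ∀ n : S, ρ n = 1 → a.1 1 n = 0 := fun n hn => hres ⟨n, hn⟩
  have hn : ∀ x n : S, ρ n = 1 → a.1 1 (x * n) = a.1 1 x := fun x n hn => by
    have h1 := hcob' 1 x (x * n)
    have h2 := hcob' 1 x x
    have e : ρ (x * n) = ρ x := by rw [map_mul, hn, mul_one]
    rw [e, ← h2] at h1
    have h3 := cochain_one_inv q a x 1 n
    have h4 := cochain_one_inv q a x 1 1
    rw [mul_one] at h3 h4
    rw [h3, h4, hc1 n hn, hc1 1 (map_one _)] at h1
    exact (sub_eq_zero.1 (by simpa using h1)).symm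
  have hdep : ∀ x y : S, ρ x = ρ y → a.1 1 x = a.1 1 y := fun x y hxy => by
    have := hn x (x⁻¹ * y) (by rw [map_mul, map_inv, hxy, inv_mul_cancel])
    rw [mul_inv_cancel_left] at this
    exact this.symm
  let β : Q → ZMod q := fun x => (a.1 1 (σ x)).down
  have hβ : ∀ x : S, β (ρ x) = (a.1 1 x).down := fun x =>
    congrArg ULift.down (hdep _ _ (hσ _))
  have hβc : Continuous β := by
    rw [((map_continuous ρ).isClosedMap.isQuotientMap (map_continuous ρ) hρ).continuous_iff]
    have e : β ∘ ρ = fun x => (a.1 1 x).down := funext hβ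
    rw [e]
    exact continuous_uliftDown.comp (map_continuous (a.1 1))
  obtain ⟨b, hb⟩ := exists_cochain_one q (S := Q)
    ⟨fun x => β (x.1⁻¹ * x.2), by fun_prop⟩ (fun g x y => by simp [mul_assoc])
  have hba : ∀ x y : S, b.1 (ρ x) (ρ y) = a.1 x y := fun x y => by
    rw [hb]
    apply ULift.ext
    have := hβ (x⁻¹ * y)
    rw [map_mul, map_inv] at this
    simp only [ContinuousMap.coe_mk, this]
    have h3 := cochain_one_inv q a x 1 (x⁻¹ * y)
    rw [mul_one, mul_inv_cancel_left] at h3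
    rw [h3]
  refine class_eq_zero q z b (cochain_two_ext q fun x y t => ?_)
  obtain ⟨x, rfl⟩ := hρ x
  obtain ⟨y, rfl⟩ := hρ y
  obtain ⟨t, rfl⟩ := hρ t
  rw [d_one_two_apply, hba, hba, hba, hcob']

/-- The class of `z` depends only on `φ`, and additively so. -/
lemma class_eq_add_of_isTransgressionPair [CompactSpace S] [TotallyDisconnectedSpace S]
    [T2Space Q] (ρ : S →ₜ* Q) (hρ : Function.Surjective ρ) {φ ψ χ : C(ρ.toMonoidHom.ker, ZMod q)}
    {a b c : (cochains q S).X 1} {x y z : ContinuousCohomology.cocycles (trivialCoeff q Q) 2}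
    (h1 : IsTransgressionPair q ρ φ a x) (h2 : IsTransgressionPair q ρ ψ b y)
    (h3 : IsTransgressionPair q ρ χ c z) (hχ : χ = φ + ψ) :
    (ContinuousCohomology.π (trivialCoeff q Q) 2).hom z =
      (ContinuousCohomology.π (trivialCoeff q Q) 2).hom x +
        (ContinuousCohomology.π (trivialCoeff q Q) 2).hom y := by
  subst hχ
  have h := class_eq_zero_of_isTransgressionPair_zero q ρ hρ (z := z - (x + y))
    (a := c - (a + b)) ⟨fun n => by
      refine (congrArg₂ (· - ·) (h3.restrict n)
        (congrArg₂ (· + ·) (h1.restrict n) (h2.restrict n))).trans ?_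
      apply ULift.ext
      exact sub_self (φ n + ψ n), by
    rw [map_sub, map_add, h1.coboundary, h2.coboundary, h3.coboundary, map_sub, map_add,
      map_sub, map_add]⟩
  rw [map_sub, map_add, sub_eq_zero] at h
  exact h

/-- The transgression `H¹(N)^S → H²(Q)` for a surjection `ρ : S → Q` with kernel `N`. It sends
`φ` to the class of any `2`-cocycle `z` that is related to `φ` by the defining relation. -/
def transgression [CompactSpace S] [TotallyDisconnectedSpace S] [T2Space Q]
    (ρ : S →ₜ* Q) (hρ : Function.Surjective ρ) :
    invariantHoms q ρ.toMonoidHom.ker →+ cohomologyZMod q 2 Q :=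
  AddMonoidHom.mk'
    (fun φ => (ContinuousCohomology.π (trivialCoeff q Q) 2).hom
      (exists_isTransgressionPair q ρ hρ φ).choose_spec.choose)
    (fun φ ψ => class_eq_add_of_isTransgressionPair q ρ hρ
      (exists_isTransgressionPair q ρ hρ φ).choose_spec.choose_spec
      (exists_isTransgressionPair q ρ hρ ψ).choose_spec.choose_spec
      (exists_isTransgressionPair q ρ hρ (φ + ψ)).choose_spec.choose_spec rfl)

lemma transgression_eq [CompactSpace S] [TotallyDisconnectedSpace S] [T2Space Q]
    (ρ : S →ₜ* Q) (hρ : Function.Surjective ρ) (φ : invariantHoms q ρ.toMonoidHom.ker)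
    {a : (cochains q S).X 1} {z : ContinuousCohomology.cocycles (trivialCoeff q Q) 2}
    (h : IsTransgressionPair q ρ φ.1 a z) :
    transgression q ρ hρ φ = (ContinuousCohomology.π (trivialCoeff q Q) 2).hom z := by
  have h0 : IsTransgressionPair q ρ 0 0 0 := ⟨fun n => rfl, by simp only [map_zero]⟩
  have := class_eq_add_of_isTransgressionPair q ρ hρ h h0
    (exists_isTransgressionPair q ρ hρ φ).choose_spec.choose_spec (add_zero _).symm
  rw [map_zero, add_zero] at this
  exact this

end Transgression

/-! ### The duality pairing and annihilators -/

section Duality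

variable {S : Type u} [Group S] [TopologicalSpace S] [IsTopologicalGroup S] (q : ℕ)
  (N : Subgroup S) [N.Normal]

/-- `N / N^q[N,S]`. -/
abbrev qCommutatorQuotient : Type u := N ⧸ (qCommutator q N).subgroupOf N

/-- An element of `H¹(N)^S` as a homomorphism `N → ℤ/q`, with `ℤ/q` written multiplicatively. -/
def invariantHomToHom (φ : invariantHoms q N) : N →* Multiplicative (ZMod q) :=
  MonoidHom.mk' (fun n => Multiplicative.ofAdd (φ.1 n)) (fun m n => φ.2.1 m n)

lemma subgroupOf_le_ker (φ : invariantHoms q N) :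
    (qCommutator q N).subgroupOf N ≤ (invariantHomToHom q N φ).ker := by
  have hclosed : IsClosed {n : N | φ.1 n = 0} := isClosed_singleton.preimage φ.1.2
  obtain ⟨C, hC, hCφ⟩ := isClosed_induced_iff.1 hclosed
  have hle : Subgroup.closure ({x | ∃ n ∈ N, x = n ^ q} ∪
      {x | ∃ n ∈ N, ∃ g : S, x = n⁻¹ * g⁻¹ * n * g}) ≤
      (invariantHomToHom q N φ).ker.map N.subtype := by
    rw [Subgroup.closure_le]
    rintro x (⟨n, hn, rfl⟩ | ⟨n, hn, g, rfl⟩)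
    · refine ⟨⟨n, hn⟩ ^ q, ?_, by simp⟩
      change invariantHomToHom q N φ _ = 1
      rw [map_pow]
      change Multiplicative.ofAdd (q • φ.1 ⟨n, hn⟩) = 1
      rw [nsmul_eq_mul, ZMod.natCast_self, zero_mul, ofAdd_zero]
    · refine ⟨⟨n, hn⟩⁻¹ * MulAut.conjNormal g⁻¹ ⟨n, hn⟩, ?_, by simp [mul_assoc]⟩
      change invariantHomToHom q N φ _ = 1
      rw [map_mul, map_inv, inv_mul_eq_one]
      exact congrArg Multiplicative.ofAdd (φ.2.2 g ⟨n, hn⟩).symm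
  intro n hn
  have hsub : (qCommutator q N : Set S) ⊆ C := by
    refine closure_minimal (fun x hx => ?_) hC
    obtain ⟨m, hm, rfl⟩ := hle hx
    have : m ∈ {n : N | φ.1 n = 0} := Multiplicative.ofAdd.injective hm
    rw [← hCφ] at this
    exact this
  have h1 : n ∈ {n : N | φ.1 n = 0} := by
    rw [← hCφ]
    exact hsub hn
  exact congrArg Multiplicative.ofAdd h1

/-- The duality pairing `N / N^q[N,S] × H¹(N)^S → ℤ/q`, `(n̄, φ) ↦ φ n`, as a homomorphism in the
first variable, with `ℤ/q` written multiplicatively. -/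
def dualityPairing (φ : invariantHoms q N) :
    qCommutatorQuotient q N →* Multiplicative (ZMod q) :=
  QuotientGroup.lift _ (invariantHomToHom q N φ) (subgroupOf_le_ker q N φ)

/-- The annihilator in `N / N^q[N,S]` of a subgroup `K` of `H¹(N)^S` under the duality pairing. -/
def annihilator (K : AddSubgroup (invariantHoms q N)) : Subgroup (qCommutatorQuotient q N) where
  carrier := {x | ∀ φ ∈ K, dualityPairing q N φ x = 1}
  one_mem' := fun φ _ => map_one _
  mul_mem' := fun hx hy φ hφ => by rw [map_mul, hx φ hφ, hy φ hφ, one_mul]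
  inv_mem' := fun hx φ hφ => by rw [map_inv, hx φ hφ, inv_one]

/-- The image in `S / M` of a subgroup `A` of `N / N^q[N,S]`, that is, the set of the classes in
`S / M` of those elements of `N` whose class in `N / N^q[N,S]` belongs to `A`. When `M = N^q[N,S]`
this is `A` itself, viewed in `S / M` through the inclusion of `N / M` in `S / M`. -/
def imageInQuotient (A : Subgroup (qCommutatorQuotient q N)) (M : Subgroup S) [M.Normal] :
    Subgroup (S ⧸ M) :=
  ((A.comap (QuotientGroup.mk' _)).map N.subtype).map (QuotientGroup.mk' M)

instance imageInQuotient_annihilator_normal (K : AddSubgroup (invariantHoms q N)) (M : Subgroup S)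
    [M.Normal] : (imageInQuotient q N (annihilator q N K) M).Normal := by
  refine Subgroup.Normal.map ?_ _ (QuotientGroup.mk'_surjective M)
  refine ⟨?_⟩
  rintro _ ⟨n, hn, rfl⟩ g
  refine ⟨MulAut.conjNormal g n, fun φ hφ => ?_, by simp⟩
  have h1 : Multiplicative.ofAdd (φ.1 n) = 1 := hn φ hφ
  have h2 := φ.2.2 g⁻¹ n
  rw [inv_inv] at h2
  change Multiplicative.ofAdd (φ.1 (MulAut.conjNormal g n)) = 1
  rw [h2, h1]

end Duality

/-! ### The map `f` -/

section MapF

variable (p : ℕ) [Fact p.Prime] (d : ℕ)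
  {G : Type u} [Group G] [TopologicalSpace G] [IsTopologicalGroup G] [CompactSpace G]
  [TotallyDisconnectedSpace G]
  {S : Type u} [Group S] [TopologicalSpace S] [IsTopologicalGroup S] [CompactSpace S]
  [TotallyDisconnectedSpace S]

/-- The composition `S → G(p) → G^[2]`. -/
def toTwo (π : S →ₜ* MaxProP p G) : S →ₜ* qCentralQuotient (p ^ d) G 2 :=
  (maxProPToTwo p d G).comp π

lemma toTwo_surjective {π : S →ₜ* MaxProP p G} (hπ : Function.Surjective π) :
    Function.Surjective (toTwo p d π) :=
  (maxProPToTwo_surjective p d G).comp hπ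

/-- `T`, the kernel of the composition `S → G(p) → G^[2]`. -/
abbrev kernelT (π : S →ₜ* MaxProP p G) : Subgroup S := (toTwo p d π).toMonoidHom.ker

/-- The composition `f : H¹(T)^S → H²(G^[2]) → H²(G(p)) → H²(G)` of the transgression and the
inflations. -/
def mapF (π : S →ₜ* MaxProP p G) (hπ : Function.Surjective π) :
    invariantHoms (p ^ d) (kernelT p d π) →+ cohomologyZMod (p ^ d) 2 G :=
  (inflation (p ^ d) 2 (quotientProj (proPKernel p G))).comp
    ((inflation (p ^ d) 2 (maxProPToTwo p d G)).comp
      (transgression (p ^ d) (toTwo p d π) (toTwo_surjective p d hπ)))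

end MapF

end

/-! ### Functoriality of the descending q-central sequence. -/

section DescendingCentral

variable {A B : Type u} [Group A] [TopologicalSpace A] [IsTopologicalGroup A]
  [Group B] [TopologicalSpace B] [IsTopologicalGroup B]

/-! Let K be the kernel of G → G(p). Every term G^(i) with i ≥ 1 contains K
(`proPKernel_le_qCentral`), and surjections carry the q-central sequence of a profinite group onto
that of its image (`map_qCentral`). So the kernel of S → G(p) → G^[3] is R S^(3), and G^[3] is S^[3]
modulo the image of R. It remains to identify that image with Ker(f)^∨.

The crux is `mapF_eq_zero_iff`: Ker(f) consists of the φ that vanish on R. Take a 1-cochain a on S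
that restricts to φ on T and whose coboundary is inflated from a cocycle z of G^[2]. If φ kills R,
then a descends to G(p), and z becomes a coboundary on G(p), hence on G. Conversely, let z become
the coboundary of b on G. Then b restricts to a G-invariant homomorphism on K, which is zero by
`invariantHoms_proPKernel_eq_zero`, so b descends to G(p); this is the injectivity of H²(G(p)) →
H²(G). The difference of a and the pullback of b to S is a homomorphism S → ℤ/q. It vanishes on
S^(2), which contains R by minimality, and therefore φ vanishes on R.

Finally, invariant homomorphisms on T that vanish on the closed subgroup R S^(3) separate it from
the other points of T (`exists_invariantHom_ne_zero`). So the annihilator of Ker(f) is exactly the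
image of R. -/

lemma qCommutator_le {q : ℕ} {N M : Subgroup A} (hM : IsClosed (M : Set A))
    (hpow : ∀ n ∈ N, n ^ q ∈ M) (hcomm : ∀ n ∈ N, ∀ g : A, n⁻¹ * g⁻¹ * n * g ∈ M) :
    qCommutator q N ≤ M := by
  refine Subgroup.topologicalClosure_minimal _ ((Subgroup.closure_le _).2 ?_) hM
  rintro x (⟨n, hn, rfl⟩ | ⟨n, hn, g, rfl⟩)
  · exact hpow n hn
  · exact hcomm n hn g

lemma qCentral_succ_le (q : ℕ) : ∀ i, qCentral q A (i + 1) ≤ qCentral q A i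
  | 0 => le_top
  | i + 1 => by
      have hN : (qCentral q A (i + 1)).Normal := inferInstance
      refine qCommutator_le (isClosed_qCentral q (i + 1)) (fun n hn => pow_mem hn q)
        fun n hn g => ?_
      have := mul_mem (inv_mem hn) (hN.conj_mem n hn g⁻¹)
      simpa [mul_assoc] using this

/-- Compactness makes the image of a closed subgroup closed, so it contains the closure of the
subgroup generated by the images of the generators. Surjectivity is needed to lift the arbitrary
second entry of a commutator. -/
lemma map_qCommutator [CompactSpace A] [T2Space B] (q : ℕ) (θ : A →ₜ* B)
    (hθ : Function.Surjective θ) (N : Subgroup A) :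
    (qCommutator q N).map θ.toMonoidHom = qCommutator q (N.map θ.toMonoidHom) := by
  have hclosed : IsClosed (((qCommutator q N).map θ.toMonoidHom : Subgroup B) : Set B) :=
    ((isClosed_qCommutator q N).isCompact.image (map_continuous θ)).isClosed
  refine le_antisymm ?_ (qCommutator_le hclosed ?_ ?_)
  · rw [Subgroup.map_le_iff_le_comap]
    refine qCommutator_le ((isClosed_qCommutator q _).preimage (map_continuous θ))
      (fun n hn => ?_) fun n hn g => ?_
    · rw [Subgroup.mem_comap, map_pow]
      exact pow_mem_qCommutator q _ (Subgroup.mem_map_of_mem _ hn)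
    · simp only [Subgroup.mem_comap, map_mul, map_inv]
      exact comm_mem_qCommutator q _ (Subgroup.mem_map_of_mem _ hn) _
  · rintro _ ⟨n, hn, rfl⟩
    exact ⟨n ^ q, pow_mem_qCommutator q N hn, map_pow _ _ _⟩
  · rintro _ ⟨n, hn, rfl⟩ g
    obtain ⟨g, rfl⟩ := hθ g
    exact ⟨_, comm_mem_qCommutator q N hn g, by simp⟩

lemma map_qCentral [CompactSpace A] [T2Space B] (q : ℕ) (θ : A →ₜ* B)
    (hθ : Function.Surjective θ) :
    ∀ i, (qCentral q A i).map θ.toMonoidHom = qCentral q B i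
  | 0 => Subgroup.map_top_of_surjective _ hθ
  | 1 => Subgroup.map_top_of_surjective _ hθ
  | i + 2 => by rw [qCentral, qCentral, map_qCommutator q θ hθ, map_qCentral q θ hθ (i + 1)]

/-- Each step down the sequence costs one more q-th power. This bounds the exponent of the quotients
A^[i+1]. -/
lemma pow_pow_mem_qCentral (q : ℕ) (g : A) : ∀ i, g ^ q ^ i ∈ qCentral q A (i + 1)
  | 0 => Subgroup.mem_top _
  | i + 1 => by
      rw [pow_succ, pow_mul]
      exact pow_mem_qCommutator q _ (pow_pow_mem_qCentral q g i)

/-- A continuous homomorphism to `ℤ/q` vanishes on `A^(2)`. -/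
lemma apply_eq_zero_of_mem_qCentral_two (q : ℕ) (h : C(A, ZMod q))
    (hadd : ∀ x y, h (x * y) = h x + h y) {x : A} (hx : x ∈ qCentral q A 2) : h x = 0 := by
  let η : A →* Multiplicative (ZMod q) :=
    MonoidHom.mk' (fun x => Multiplicative.ofAdd (h x)) hadd
  have hη : IsClosed (η.ker : Set A) := by
    have e : (η.ker : Set A) = h ⁻¹' {0} := rfl
    rw [e]
    exact isClosed_singleton.preimage h.continuous
  have hle : qCentral q A 2 ≤ η.ker := by
    refine qCommutator_le hη (fun n _ => ?_) fun n _ g => ?_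
    · rw [MonoidHom.mem_ker, map_pow]
      change Multiplicative.ofAdd (q • h n) = 1
      rw [nsmul_eq_mul, ZMod.natCast_self, zero_mul, ofAdd_zero]
    · rw [MonoidHom.mem_ker, map_mul, map_mul, map_mul, map_inv, map_inv, mul_right_comm,
        inv_mul_cancel_right, inv_mul_cancel]
  exact hle hx

end DescendingCentral

/-! ### The kernel of G → G(p). -/

section ProP

variable (p : ℕ) (G : Type u) [Group G] [TopologicalSpace G]

variable [IsTopologicalGroup G]

lemma isClosed_proPKernel : IsClosed (proPKernel p G : Set G) := by
  rw [proPKernel, Subgroup.coe_sInf]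
  exact isClosed_biInter fun U hU => U.isClosed_of_isOpen hU.2.1

instance maxProP_t2 : T2Space (MaxProP p G) :=
  haveI := isClosed_proPKernel p G
  QuotientGroup.instT2Space

variable {p G}

/-- If some `p`-power of every element lies in the open normal subgroup `V`, then the index of `V`
is a power of `p`. -/
lemma proPKernel_le_of_forall_pow_mem [Fact p.Prime] [CompactSpace G] {V : Subgroup G} [V.Normal]
    (hV : IsOpen (V : Set G)) (h : ∀ g : G, ∃ k : ℕ, g ^ p ^ k ∈ V) : proPKernel p G ≤ V := by
  have hfin := Subgroup.quotient_finite_of_isOpen V hV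
  have hpg : IsPGroup p (G ⧸ V) := by
    intro y
    obtain ⟨g, rfl⟩ := QuotientGroup.mk_surjective y
    obtain ⟨k, hk⟩ := h g
    exact ⟨k, (QuotientGroup.eq_one_iff _).2 hk⟩
  exact sInf_le ⟨inferInstance, hV, IsPGroup.iff_card.1 hpg⟩

/-- An open neighbourhood of the kernel of `G → G(p)` contains a normal subgroup of `p`-power
index. -/
lemma exists_index_eq_pow_of_proPKernel_subset [Fact p.Prime] [CompactSpace G]
    {O : Set G} (hO : IsOpen O) (h : (proPKernel p G : Set G) ⊆ O) :
    ∃ U : Subgroup G, U.Normal ∧ (∃ k : ℕ, U.index = p ^ k) ∧ (U : Set G) ⊆ O := by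
  let I := {U : Subgroup G | U.Normal ∧ IsOpen (U : Set G) ∧ ∃ k : ℕ, U.index = p ^ k}
  have : Nonempty I := ⟨⟨⊤, inferInstance, isOpen_univ, 0, by simp⟩⟩
  -- The family is closed under intersection because the index of U ⊓ V divides p ^ (k + l);
  -- compactness then finds one member inside `O`.
  have hdir : Directed (· ⊇ ·) fun U : I => ((U : Subgroup G) : Set G) := by
    rintro ⟨U, hU, hUo, k, hk⟩ ⟨V, hV, hVo, l, hl⟩
    refine ⟨⟨U ⊓ V, inferInstance, hUo.inter hVo, ?_⟩, Set.inter_subset_left,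
      Set.inter_subset_right⟩
    obtain ⟨m, -, hm⟩ := (Nat.dvd_prime_pow (m := k + l) Fact.out).1 (show (U ⊓ V).index ∣ _ by
      rw [pow_add, ← hk, ← hl, ← Subgroup.relIndex_mul_index (inf_le_left : U ⊓ V ≤ U), mul_comm,
        Subgroup.inf_relIndex_left]
      exact mul_dvd_mul_left _ (Subgroup.relIndex_dvd_index_of_normal V U))
    exact ⟨m, hm⟩
  obtain ⟨⟨U, hU⟩, hUO⟩ := exists_subset_nhds_of_compactSpace hdir
    (fun U => U.1.isClosed_of_isOpen U.2.2.1) (U := O) (fun x hx => hO.mem_nhds (h (by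
      rw [SetLike.mem_coe, proPKernel, Subgroup.mem_sInf]
      exact fun U hU => Set.mem_iInter.1 hx ⟨U, hU⟩)))
  exact ⟨U, hU.1, hU.2.2, hUO⟩

variable [CompactSpace G] [TotallyDisconnectedSpace G]

/-- In a profinite group, a point outside a closed normal subgroup `M` is outside `U M` for some
open normal subgroup `U`. -/
lemma exists_openNormalSubgroup_notMem_sup {M : Subgroup G} [M.Normal]
    (hM : IsClosed (M : Set G)) {x : G} (hx : x ∉ M) :
    ∃ U : OpenNormalSubgroup G, x ∉ U.toSubgroup ⊔ M := by
  have hopen : IsOpen {u : G | x * u ∉ M} :=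
    (hM.preimage (continuous_const_mul x)).isOpen_compl
  obtain ⟨U, hU⟩ := ProfiniteGrp.exist_openNormalSubgroup_sub_open_nhds_of_one hopen
    (by simpa using hx)
  refine ⟨U, fun h => ?_⟩
  obtain ⟨u, hu, c, hc, rfl⟩ := Subgroup.mem_sup_of_normal_left.1 h
  -- With x = u c, the conjugate x⁻¹ u⁻¹ x lies in U, and x times it is c ∈ M, against the choice of
  -- U.
  refine hU (U.isNormal'.conj_mem _ (inv_mem hu) (u * c)⁻¹ : _ ∈ U.toSubgroup) ?_
  have e : u * c * ((u * c)⁻¹ * u⁻¹ * (u * c)⁻¹⁻¹) = c := by group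
  rw [e]
  exact hc

lemma isOpen_openNormalSubgroup_sup (U : OpenNormalSubgroup G) (M : Subgroup G) :
    IsOpen ((U.toSubgroup ⊔ M : Subgroup G) : Set G) :=
  Subgroup.isOpen_mono le_sup_left U.isOpen'

/-- G^(i+1) is the intersection of the open subgroups U G^(i+1). The quotient by each of these is
killed by the power q^i = p^(d i), hence is a finite p-group. -/
lemma proPKernel_le_qCentral [Fact p.Prime] (d i : ℕ) :
    proPKernel p G ≤ qCentral (p ^ d) G (i + 1) := by
  intro x hx
  by_contra hxC
  obtain ⟨U, hU⟩ := exists_openNormalSubgroup_notMem_sup (isClosed_qCentral (p ^ d) (i + 1)) hxC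
  refine hU (proPKernel_le_of_forall_pow_mem (isOpen_openNormalSubgroup_sup U _)
    (fun g => ⟨d * i, ?_⟩) hx)
  rw [pow_mul]
  exact (le_sup_right : qCentral (p ^ d) G (i + 1) ≤ _) (pow_pow_mem_qCentral _ g i)

/-- The kernel `K` of `G → G(p)` satisfies `H¹(K)^G = 0`. -/
lemma invariantHoms_proPKernel_eq_zero [Fact p.Prime] (d : ℕ)
    (φ : invariantHoms (p ^ d) (proPKernel p G)) (k : proPKernel p G) : φ.1 k = 0 := by
  have hφ1 : φ.1 1 = 0 := by simpa using φ.2.1 1 1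
  -- The kernel of φ, viewed in G, where invariance of φ makes it normal. The goal is K = L, with K
  -- the kernel of G → G(p).
  let L : Subgroup G := (invariantHomToHom (p ^ d) (proPKernel p G) φ).ker.map (proPKernel p G).subtype
  have hL : ∀ k : proPKernel p G, (k : G) ∈ L → φ.1 k = 0 := by
    rintro k ⟨l, hl, h⟩
    rw [← Subtype.ext h]
    exact Multiplicative.ofAdd.injective hl
  have hLmem : ∀ k : proPKernel p G, φ.1 k = 0 → (k : G) ∈ L := fun k hk =>
    ⟨k, congrArg Multiplicative.ofAdd hk, rfl⟩
  have hLn : L.Normal := by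
    refine ⟨?_⟩
    rintro _ ⟨n, hn, rfl⟩ g
    have h1 : φ.1 n = 0 := Multiplicative.ofAdd.injective hn
    have h2 := hLmem (MulAut.conjNormal g n) (by
      have := φ.2.2 g⁻¹ n
      rw [inv_inv] at this
      rw [this, h1])
    simpa using h2
  obtain ⟨W, hW, hWφ⟩ :=
    isOpen_induced_iff.1 ((isOpen_discrete {(0 : ZMod (p ^ d))}).preimage φ.1.2)
  obtain ⟨U, hU⟩ := ProfiniteGrp.exist_openNormalSubgroup_sub_open_nhds_of_one hW
    (show (1 : G) ∈ W by
      have : (1 : proPKernel p G) ∈ (Subtype.val ⁻¹' W : Set (proPKernel p G)) := by rw [hWφ]; exact hφ1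
      exact this)
  have hUL : ∀ k : proPKernel p G, (k : G) ∈ U.toSubgroup → (k : G) ∈ L := fun k hk => by
    have : k ∈ (Subtype.val ⁻¹' W : Set (proPKernel p G)) := hU hk
    rw [hWφ] at this
    exact hLmem k this
  -- U is chosen so that φ vanishes on U ∩ K. As U K is an open neighbourhood of K, it contains some
  -- V of index p^m.
  obtain ⟨V, hVn, ⟨m, hm⟩, hVU⟩ := exists_index_eq_pow_of_proPKernel_subset
    (isOpen_openNormalSubgroup_sup U (proPKernel p G)) (le_sup_right : proPKernel p G ≤ U.toSubgroup ⊔ proPKernel p G)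
  -- A p^m-th power lands in U K, and a further p^d-th power moves the K-component into L. So G / U
  -- L is a p-group and K ≤ U L.
  have hkUL : (k : G) ∈ U.toSubgroup ⊔ L := by
    refine proPKernel_le_of_forall_pow_mem (isOpen_openNormalSubgroup_sup U L)
      (fun g => ⟨m + d, ?_⟩) k.2
    have hgm : g ^ p ^ m ∈ U.toSubgroup ⊔ proPKernel p G := hVU (by rw [← hm]; exact V.pow_index_mem g)
    obtain ⟨u, hu, y, hy, hg⟩ := Subgroup.mem_sup_of_normal_left.1 hgm
    have hyL : y ^ p ^ d ∈ L := by
      refine hLmem (⟨y, hy⟩ ^ p ^ d) (Multiplicative.ofAdd.injective ?_)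
      change invariantHomToHom (p ^ d) (proPKernel p G) φ (⟨y, hy⟩ ^ p ^ d) = 1
      rw [map_pow]
      change Multiplicative.ofAdd ((p ^ d) • φ.1 ⟨y, hy⟩) = 1
      rw [nsmul_eq_mul, ZMod.natCast_self, zero_mul, ofAdd_zero]
    rw [pow_add, pow_mul, ← hg, ← QuotientGroup.eq_one_iff, QuotientGroup.mk_pow,
      QuotientGroup.mk_mul, (QuotientGroup.eq_one_iff u).2 ((le_sup_left : U.toSubgroup ≤ _) hu),
      one_mul, ← QuotientGroup.mk_pow, QuotientGroup.eq_one_iff]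
    exact (le_sup_right : L ≤ _) hyL
  -- Modular law: in k = u l with l ∈ L ≤ K, the factor u lies in U ∩ K ≤ L.
  obtain ⟨u, hu, l, hl, huk⟩ := Subgroup.mem_sup_of_normal_left.1 hkUL
  obtain ⟨l', hl', rfl⟩ := id hl
  have h1 := hUL (k * l'⁻¹) (by
    push_cast
    rw [← huk]
    simpa using hu)
  refine hL k ?_
  rw [← huk]
  change u * (l' : G) ∈ L
  have h2 : u = ((k * l'⁻¹ : proPKernel p G) : G) := by
    push_cast
    rw [← huk]
    simp
  rw [h2]
  exact mul_mem h1 hl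

end ProP

/-! ### Separation of points by invariant homomorphisms. -/

section Duality

/-- In a finite abelian group of exponent dividing `q`, homomorphisms to `ℤ/q` separate points. -/
lemma exists_hom_zmod_ne_zero {A : Type*} [CommGroup A] [Finite A] {q : ℕ} [NeZero q]
    (hA : ∀ x : A, x ^ q = 1) {x : A} (hx : x ≠ 1) :
    ∃ χ : A →* Multiplicative (ZMod q), χ x ≠ 1 := by
  have hq : Monoid.exponent A ∣ q := Monoid.exponent_dvd_of_forall_pow_eq_one hA
  have : NeZero (Monoid.exponent A) := ⟨fun h => NeZero.ne q (Nat.eq_zero_of_zero_dvd (h ▸ hq))⟩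
  obtain ⟨χ, hχ⟩ := CommGroup.exists_apply_ne_one_of_hasEnoughRootsOfUnity A ℂ hx
  -- A separating complex character takes values in the q-th roots of unity, which form a cyclic
  -- group of order q.
  let χ' : A →* rootsOfUnity q ℂ := χ.codRestrict _ fun y => by
    rw [mem_rootsOfUnity, ← map_pow, hA, map_one]
  let e : rootsOfUnity q ℂ ≃* Multiplicative (ZMod q) := mulEquivOfCyclicCardEq (by
    rw [Complex.card_rootsOfUnity, Nat.card_congr Multiplicative.toAdd, Nat.card_zmod])
  refine ⟨e.toMonoidHom.comp χ', fun h => hχ ?_⟩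
  exact congrArg Subtype.val (e.map_eq_one_iff.1 h)

variable {S : Type u} [Group S] [TopologicalSpace S] [IsTopologicalGroup S] [CompactSpace S]
  [TotallyDisconnectedSpace S]

/-- Elements of `H¹(T)^S` separate the points of `T` from a closed normal subgroup `M` of `S`
that contains `T^q[T,S]`. -/
lemma exists_invariantHom_ne_zero {q : ℕ} [NeZero q] (T : Subgroup S) [T.Normal] (M : Subgroup S)
    [M.Normal] (hM : IsClosed (M : Set S)) (hTM : qCommutator q T ≤ M)
    (t : T) (ht : (t : S) ∉ M) :
    ∃ φ : invariantHoms q T, (∀ n : T, (n : S) ∈ M → φ.1 n = 0) ∧ φ.1 t ≠ 0 := by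
  obtain ⟨U, hU⟩ := exists_openNormalSubgroup_notMem_sup hM ht
  set V := U.toSubgroup ⊔ M with hVdef
  have hVo : IsOpen (V : Set S) := isOpen_openNormalSubgroup_sup U M
  have hMV : M ≤ V := le_sup_right
  have hVn : V.Normal := inferInstance
  -- The image of T in the finite group S / V is abelian of exponent dividing q, since V contains
  -- T^q[T,S]; a character of it supplies φ.
  let ρ : T →* S ⧸ V := (QuotientGroup.mk' V).comp T.subtype
  have hfin := Subgroup.quotient_finite_of_isOpen V hVo
  have hρ : ∀ n : T, ρ n = 1 ↔ (n : S) ∈ V := fun n => QuotientGroup.eq_one_iff (n : S)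
  have hcomm : ∀ a b : ρ.range, a * b = b * a := by
    rintro ⟨_, a, rfl⟩ ⟨_, b, rfl⟩
    have := (hρ (a⁻¹ * b⁻¹ * a * b)).2 (hMV (hTM (by
      simpa using comm_mem_qCommutator q T a.2 (b : S))))
    apply Subtype.ext
    simp only [map_mul, map_inv] at this
    change ρ a * ρ b = ρ b * ρ a
    have e : ρ a * ρ b = ρ b * ρ a * ((ρ a)⁻¹ * (ρ b)⁻¹ * ρ a * ρ b) := by group
    rw [e, this, mul_one]
  let _ : CommGroup ρ.range := { (inferInstance : Group ρ.range) with mul_comm := hcomm }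
  have hexp : ∀ a : ρ.range, a ^ q = 1 := by
    rintro ⟨_, a, rfl⟩
    apply Subtype.ext
    change ρ a ^ q = 1
    rw [← map_pow, hρ]
    exact hMV (hTM (by simpa using pow_mem_qCommutator q T a.2))
  obtain ⟨χ, hχ⟩ := exists_hom_zmod_ne_zero hexp (x := ρ.rangeRestrict t) (fun h =>
    hU ((hρ t).1 (congrArg Subtype.val h)))
  let ψ : T →* Multiplicative (ZMod q) := χ.comp ρ.rangeRestrict
  have hψ : ∀ n : T, (n : S) ∈ V → ψ n = 1 := fun n hn => by
    have : ρ.rangeRestrict n = 1 := Subtype.ext ((hρ n).2 hn)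
    change χ (ρ.rangeRestrict n) = 1
    rw [this, map_one]
  have hcont : Continuous fun n : T => (ψ n).toAdd := by
    refine IsLocallyConstant.continuous ((IsLocallyConstant.iff_exists_open _).2 fun s => ?_)
    refine ⟨(fun n : T => (s : S)⁻¹ * n) ⁻¹' (V : Set S),
      hVo.preimage (by fun_prop), by simp [one_mem], fun n hn => ?_⟩
    have h1 := hψ (s⁻¹ * n) (by simpa using hn)
    rw [map_mul, map_inv, inv_mul_eq_one] at h1
    exact congrArg Multiplicative.toAdd h1.symm
  refine ⟨⟨⟨fun n => (ψ n).toAdd, hcont⟩, fun m n => congrArg Multiplicative.toAdd (map_mul ψ m n),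
    fun s n => ?_⟩, fun n hn => congrArg Multiplicative.toAdd (hψ n (hMV hn)), fun h => hχ h⟩
  -- Invariance holds because [n,s] lies in T^q[T,S] ≤ V, where ψ is trivial.
  have h1 := hψ (n⁻¹ * MulAut.conjNormal s⁻¹ n) (hMV (hTM (by
    simpa [mul_assoc] using comm_mem_qCommutator q T n.2 s)))
  rw [map_mul, map_inv, inv_mul_eq_one] at h1
  exact congrArg Multiplicative.toAdd h1.symm

end Duality

/-! ### Vanishing and inflation of classes in terms of cocycles. -/

section Cohomology

variable {S Q : Type u} [Group S] [TopologicalSpace S] [IsTopologicalGroup S]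
  [Group Q] [TopologicalSpace Q] [IsTopologicalGroup Q] (q : ℕ)

/-- A `2`-cocycle with trivial class is a coboundary. -/
lemma exists_coboundary_of_class_eq_zero
    (z : ContinuousCohomology.cocycles (trivialCoeff q Q) 2)
    (h : (ContinuousCohomology.π (trivialCoeff q Q) 2).hom z = 0) :
    ∃ b : (cochains q Q).X 1,
      ((cochains q Q).d 1 2).hom b = ((cochains q Q).iCycles 2).hom z := by
  let K := cochains q Q
  have hK : K.toCycles 1 2 ≫ TopModuleCat.cokerπ (K.toCycles 1 2) = 0 :=
    TopModuleCat.comp_cokerπ _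
  -- Comparing the homology with the concrete cokernel of `K.toCycles 1 2` turns a trivial class
  -- into membership in the range of the differential.
  let e : K.homology 2 ⟶ TopModuleCat.coker (K.toCycles 1 2) :=
    (K.homologyIsCokernel 1 2 (by simp)).desc (Limits.CokernelCofork.ofπ _ hK)
  have he : K.homologyπ 2 ≫ e = TopModuleCat.cokerπ (K.toCycles 1 2) :=
    (K.homologyIsCokernel 1 2 (by simp)).fac (Limits.CokernelCofork.ofπ _ hK)
      Limits.WalkingParallelPair.one
  have h1 : (TopModuleCat.cokerπ (K.toCycles 1 2)).hom z = 0 := by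
    rw [← he]
    change e.hom ((K.homologyπ 2).hom z) = 0
    exact (congrArg e.hom h).trans (map_zero _)
  obtain ⟨b, hb⟩ := (Submodule.Quotient.mk_eq_zero _).1 h1
  refine ⟨b, ?_⟩
  rw [← hb]
  exact (congrArg (fun f => f.hom b) (K.toCycles_i 1 2)).symm

lemma class_eq_zero_iff (z : ContinuousCohomology.cocycles (trivialCoeff q Q) 2) :
    (ContinuousCohomology.π (trivialCoeff q Q) 2).hom z = 0 ↔ ∃ b : (cochains q Q).X 1,
      ((cochains q Q).d 1 2).hom b = ((cochains q Q).iCycles 2).hom z :=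
  ⟨exists_coboundary_of_class_eq_zero q z, fun ⟨b, hb⟩ => class_eq_zero q z b hb⟩

/-- The inflation of the class of a cocycle is the class of its pullback. -/
lemma exists_inflation_class_eq (ρ : S →ₜ* Q)
    (z : ContinuousCohomology.cocycles (trivialCoeff q Q) 2) :
    ∃ w : ContinuousCohomology.cocycles (trivialCoeff q S) 2,
      inflation q 2 ρ ((ContinuousCohomology.π (trivialCoeff q Q) 2).hom z) =
        (ContinuousCohomology.π (trivialCoeff q S) 2).hom w ∧
      ((cochains q S).iCycles 2).hom w =
        ((cochainsPullback q ρ).f 2).hom (((cochains q Q).iCycles 2).hom z) := by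
  let F := cochainsPullback q ρ
  refine ⟨(HomologicalComplex.cyclesMap F 2).hom z, ?_, ?_⟩
  · exact congrArg (fun f => f.hom z) (HomologicalComplex.homologyπ_naturality F 2)
  · exact congrArg (fun f => f.hom z) (HomologicalComplex.cyclesMap_i F 2)

end Cohomology

/-! ### The kernel of f. -/

section MapF

variable (p : ℕ) [Fact p.Prime] (d : ℕ)
  {G : Type u} [Group G] [TopologicalSpace G] [IsTopologicalGroup G] [CompactSpace G]
  [TotallyDisconnectedSpace G]
  {S : Type u} [Group S] [TopologicalSpace S] [IsTopologicalGroup S] [CompactSpace S]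
  [TotallyDisconnectedSpace S]

/-- Inflation composes cocycles with the projections, so f φ is the class of z pulled back to G, and
it vanishes exactly when this pullback is a coboundary. The equation is that condition for
homogeneous cochains. -/
lemma mapF_eq_zero_iff_exists (π : S →ₜ* MaxProP p G) (hπ : Function.Surjective π)
    (φ : invariantHoms (p ^ d) (kernelT p d π)) {a : (cochains (p ^ d) S).X 1}
    {z : ContinuousCohomology.cocycles (trivialCoeff (p ^ d) (qCentralQuotient (p ^ d) G 2)) 2}
    (h : IsTransgressionPair (p ^ d) (toTwo p d π) φ.1 a z) :
    mapF p d π hπ φ = 0 ↔ ∃ b : (cochains (p ^ d) G).X 1, ∀ x y t : G,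
      b.1 y t - (b.1 x t - b.1 x y) =
        (((cochains (p ^ d) (qCentralQuotient (p ^ d) G 2)).iCycles 2).hom z).1 x y t := by
  obtain ⟨z₁, h1, h1'⟩ := exists_inflation_class_eq (p ^ d) (maxProPToTwo p d G) z
  obtain ⟨z₂, h2, h2'⟩ := exists_inflation_class_eq (p ^ d) (quotientProj (proPKernel p G)) z₁
  have e : mapF p d π hπ φ =
      (ContinuousCohomology.π (trivialCoeff (p ^ d) G) 2).hom z₂ := by
    rw [← h2, ← h1, ← transgression_eq (p ^ d) (toTwo p d π) (toTwo_surjective p d hπ) φ h]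
    rfl
  rw [e, class_eq_zero_iff]
  refine exists_congr fun b => ⟨fun hb x y t => ?_, fun hb => cochain_two_ext _ fun x y t => ?_⟩
  · rw [← d_one_two_apply, hb, h2', cochainsPullback_two_apply, h1', cochainsPullback_two_apply]
    rfl
  · rw [d_one_two_apply, h2', cochainsPullback_two_apply, h1', cochainsPullback_two_apply, hb]
    rfl

/-- If `R ≤ S^(2)`, then `f φ = 0` if and only if `φ` vanishes on `R`. -/
lemma mapF_eq_zero_iff (π : S →ₜ* MaxProP p G) (hπ : Function.Surjective π)
    (hmin : π.toMonoidHom.ker ≤ qCentral (p ^ d) S 2)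
    (φ : invariantHoms (p ^ d) (kernelT p d π)) :
    mapF p d π hπ φ = 0 ↔ ∀ n : kernelT p d π, π n = 1 → φ.1 n = 0 := by
  obtain ⟨a, z, haz⟩ := exists_isTransgressionPair (p ^ d) (toTwo p d π)
    (toTwo_surjective p d hπ) φ
  rw [mapF_eq_zero_iff_exists p d π hπ φ haz]
  set w := ((cochains (p ^ d) (qCentralQuotient (p ^ d) G 2)).iCycles 2).hom z with hw
  have haw : ∀ x y t : S, a.1 y t - (a.1 x t - a.1 x y) =
      w.1 (toTwo p d π x) (toTwo p d π y) (toTwo p d π t) := fun x y t => by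
    rw [← d_one_two_apply, haz.coboundary]
    rfl
  have hφ1 : φ.1 1 = 0 := by simpa using φ.2.1 1 1
  have ha1 : a.1 1 1 = 0 := (haz.restrict 1).trans (congrArg ULift.up hφ1)
  have haa : ∀ x : S, a.1 x x = 0 := fun x => by
    have := cochain_one_inv (p ^ d) a x 1 1
    rwa [mul_one, ha1] at this
  have hRT : ∀ r : S, π r = 1 → toTwo p d π r = 1 := fun r hr =>
    (congrArg (maxProPToTwo p d G) hr).trans (map_one _)
  have hlift : ∀ (s : S) (x : G), π s = (x : MaxProP p G) →
      toTwo p d π s = (x : qCentralQuotient (p ^ d) G 2) := fun s x hs =>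
    congrArg (maxProPToTwo p d G) hs
  have hex : ∀ x : G, ∃ s : S, π s = (x : MaxProP p G) := fun x => hπ _
  have hex' : ∀ s : S, ∃ x : G, π s = (x : MaxProP p G) := fun s =>
    (QuotientGroup.mk_surjective (π s)).imp fun _ h => h.symm
  constructor
  · rintro ⟨b, hb⟩ r hr
    have hbb : ∀ x : G, b.1 x x = 0 := fun x => by
      obtain ⟨s, hs⟩ := hex x
      have h1 := hb x x x
      have h2 := haw s s s
      rw [hlift s x hs, ← h1, haa] at h2
      simpa using h2.symm
    -- As K ≤ G^(2), the triples (1, x, x k) and (1, x, x) agree in G^[2], so the coboundary of b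
    -- vanishes on the first as it does on the second.
    have hbK : ∀ x k : G, k ∈ proPKernel p G → b.1 1 (x * k) = b.1 1 x + b.1 1 k :=
        fun x k hk => by
      have hk2 : ((x * k : G) : qCentralQuotient (p ^ d) G 2) = x :=
        QuotientGroup.mk_mul_of_mem x (proPKernel_le p G d hk)
      have h1 := hb 1 x (x * k)
      rw [hk2, ← hb 1 x x, hbb] at h1
      have h2 := cochain_one_inv (p ^ d) b x 1 k
      rw [mul_one] at h2
      rw [h2] at h1
      simp only [sub_self, sub_eq_zero] at h1
      rw [h1]
      abel
    have hKb : ∀ k x : G, k ∈ proPKernel p G → b.1 1 (k * x) = b.1 1 k + b.1 1 x :=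
        fun k x hk => by
      have hk1 : ((k : G) : qCentralQuotient (p ^ d) G 2) = (1 : G) :=
        (QuotientGroup.eq_one_iff k).2 (proPKernel_le p G d hk)
      have hk2 : ((k * x : G) : qCentralQuotient (p ^ d) G 2) = x := by
        rw [QuotientGroup.mk_mul, hk1, QuotientGroup.mk_one, one_mul]
      have h1 := hb 1 k (k * x)
      rw [hk2, hk1, ← hb 1 1 x, hbb] at h1
      have h2 := cochain_one_inv (p ^ d) b k 1 x
      rw [mul_one] at h2
      rw [h2] at h1
      simp only [sub_zero, sub_self] at h1
      rw [← sub_eq_zero, ← neg_eq_zero, ← h1]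
      abel
    have hbcont : Continuous fun x : G => (b.1 1 x).down :=
      continuous_uliftDown.comp (map_continuous (b.1 1))
    -- Invariance follows by expanding b(1, k g) in two ways, using k g = g (g⁻¹ k g).
    let ψ : invariantHoms (p ^ d) (proPKernel p G) :=
      ⟨⟨fun k => (b.1 1 (k : G)).down, hbcont.comp continuous_subtype_val⟩,
        fun m n => congrArg ULift.down (hbK m n n.2), fun g k => by
          have h1 := hbK g _ (MulAut.conjNormal g⁻¹ k).2
          have h2 := hKb k g k.2
          have e : g * ((MulAut.conjNormal g⁻¹ k : proPKernel p G) : G) = k * g := by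
            simp [mul_assoc]
          rw [e, h2, add_comm, add_right_inj] at h1
          exact congrArg ULift.down h1.symm⟩
    have hψ : ∀ k ∈ proPKernel p G, b.1 1 k = 0 := fun k hk =>
      ULift.ext _ _ (invariantHoms_proPKernel_eq_zero d ψ ⟨k, hk⟩)
    let β : MaxProP p G → ZMod (p ^ d) := Quotient.lift (fun x : G => (b.1 1 x).down)
      fun x y hxy => by
        have h1 := hbK x (x⁻¹ * y) (QuotientGroup.leftRel_apply.1 hxy)
        rw [mul_inv_cancel_left, hψ _ (QuotientGroup.leftRel_apply.1 hxy), add_zero] at h1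
        exact congrArg ULift.down h1.symm
    have hβ : ∀ x : G, β (x : MaxProP p G) = (b.1 1 x).down := fun x => rfl
    have hβcont : Continuous β := hbcont.quotient_lift _
    -- The cochain a and the pullback of β have the same coboundary on S, so their difference is a
    -- homomorphism.
    let h : C(S, ZMod (p ^ d)) := ⟨fun s => (a.1 1 s).down - β (π s),
      (continuous_uliftDown.comp (map_continuous (a.1 1))).sub
        (hβcont.comp (map_continuous π))⟩
    have hadd : ∀ s t : S, h (s * t) = h s + h t := fun s t => by
      obtain ⟨x, hx⟩ := hex' s
      obtain ⟨y, hy⟩ := hex' t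
      have hxy : π (s * t) = ((x * y : G) : MaxProP p G) := by rw [map_mul, hx, hy]; rfl
      have h1 := haw 1 s (s * t)
      have h2 := hb 1 x (x * y)
      rw [hlift s x hx, hlift _ _ hxy, hlift 1 1 (map_one π), ← h2] at h1
      have h3 := cochain_one_inv (p ^ d) a s 1 t
      have h4 := cochain_one_inv (p ^ d) b x 1 y
      rw [mul_one] at h3 h4
      rw [h3, h4] at h1
      have h5 := congrArg ULift.down h1
      simp only [ULift.sub_down] at h5
      change (a.1 1 (s * t)).down - β (π (s * t)) =
        (a.1 1 s).down - β (π s) + ((a.1 1 t).down - β (π t))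
      rw [hx, hy, hxy, hβ, hβ, hβ]
      linear_combination -h5
    -- Minimality puts R inside S^(2), where `h` vanishes; on R the value of `h` is φ(r) - β(1), and
    -- β(1) = 0.
    have h1 := apply_eq_zero_of_mem_qCentral_two (p ^ d) h hadd (hmin (show (r : S) ∈ _ from hr))
    have h2 : (a.1 1 (r : S)).down - β (π r) = 0 := h1
    have h3 : β 1 = 0 := congrArg ULift.down (hbb 1)
    rw [hr, h3, sub_zero, haz.restrict] at h2
    exact h2
  · intro hR
    -- Since φ vanishes on R, the function a(1, ·) is constant on cosets of R and descends to G(p).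
    have haR : ∀ x r : S, π r = 1 → a.1 1 (x * r) = a.1 1 x := fun x r hr => by
      have h1 := haw 1 x (x * r)
      have e : toTwo p d π (x * r) = toTwo p d π x := by rw [map_mul, hRT r hr, mul_one]
      rw [e, ← haw 1 x x, haa] at h1
      have h2 := cochain_one_inv (p ^ d) a x 1 r
      rw [mul_one] at h2
      have h3 : a.1 1 r = 0 :=
        (haz.restrict ⟨r, hRT r hr⟩).trans (congrArg ULift.up (hR ⟨r, hRT r hr⟩ hr))
      rw [h2, h3] at h1
      exact (sub_eq_zero.1 (by simpa using h1)).symm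
    obtain ⟨σ, hσ⟩ := hπ.hasRightInverse
    let β : MaxProP p G → ZMod (p ^ d) := fun x => (a.1 1 (σ x)).down
    have hβ : ∀ s : S, β (π s) = (a.1 1 s).down := fun s => by
      have h1 := haR (σ (π s)) ((σ (π s))⁻¹ * s) (by
        rw [map_mul, map_inv, hσ, inv_mul_cancel])
      rw [mul_inv_cancel_left] at h1
      exact congrArg ULift.down h1.symm
    have hβcont : Continuous β := by
      rw [((map_continuous π).isClosedMap.isQuotientMap (map_continuous π) hπ).continuous_iff]
      have e : β ∘ π = fun x => (a.1 1 x).down := funext hβ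
      rw [e]
      exact continuous_uliftDown.comp (map_continuous (a.1 1))
    obtain ⟨b, hb⟩ := exists_cochain_one (p ^ d) (S := G)
      ⟨fun x => β (((x.1⁻¹ * x.2 : G) : MaxProP p G)),
        hβcont.comp (QuotientGroup.continuous_mk.comp (by fun_prop))⟩
      (fun g x y => by simp [mul_assoc])
    have hba : ∀ (x y : G) (s t : S), π s = (x : MaxProP p G) → π t = (y : MaxProP p G) →
        b.1 x y = a.1 s t := fun x y s t hs ht => by
      rw [hb]
      apply ULift.ext
      have e : π (s⁻¹ * t) = ((x⁻¹ * y : G) : MaxProP p G) := by rw [map_mul, map_inv, hs, ht]; rfl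
      have h1 := hβ (s⁻¹ * t)
      have h2 := cochain_one_inv (p ^ d) a s 1 (s⁻¹ * t)
      rw [mul_one, mul_inv_cancel_left] at h2
      rw [e, ← h2] at h1
      exact h1
    refine ⟨b, fun x y t => ?_⟩
    obtain ⟨x', hx⟩ := hex x
    obtain ⟨y', hy⟩ := hex y
    obtain ⟨t', ht⟩ := hex t
    rw [hba x y _ _ hx hy, hba x t _ _ hx ht, hba y t _ _ hy ht, haw, hlift _ _ hx, hlift _ _ hy,
      hlift _ _ ht]

end MapF

/-! ### Identification of Ker(f)^∨ with the image of R. -/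

section Main

variable (p : ℕ) [Fact p.Prime] (d : ℕ)
  {G : Type u} [Group G] [TopologicalSpace G] [IsTopologicalGroup G] [CompactSpace G]
  [TotallyDisconnectedSpace G]
  {S : Type u} [Group S] [TopologicalSpace S] [IsTopologicalGroup S] [CompactSpace S]
  [TotallyDisconnectedSpace S]

/-- The kernel of `S → G(p) → G^[i]` is `R S^(i)`. -/
lemma quotientMapOfLE_apply_eq_one_iff (π : S →ₜ* MaxProP p G) (hπ : Function.Surjective π)
    (i : ℕ) (h : proPKernel p G ≤ qCentral (p ^ d) G i) (s : S) :
    quotientMapOfLE _ _ h (π s) = 1 ↔ s ∈ π.toMonoidHom.ker ⊔ qCentral (p ^ d) S i := by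
  have hG := map_qCentral (p ^ d) (quotientProj (proPKernel p G)) QuotientGroup.mk_surjective i
  have hS := map_qCentral (p ^ d) π hπ i
  -- The image of G^(i) in G(p) is G(p)^(i), and its preimage is G^(i) again because G^(i) contains
  -- the kernel of G → G(p).
  have h1 : quotientMapOfLE _ _ h (π s) = 1 ↔ π s ∈ qCentral (p ^ d) (MaxProP p G) i := by
    rw [← hG]
    obtain ⟨g, hg⟩ := QuotientGroup.mk_surjective (π s)
    rw [← hg]
    change (g : G ⧸ qCentral (p ^ d) G i) = 1 ↔ _
    rw [QuotientGroup.eq_one_iff]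
    refine ⟨fun hx => ⟨g, hx, rfl⟩, ?_⟩
    rintro ⟨x, hx, hxg⟩
    have h2 : x⁻¹ * g ∈ qCentral (p ^ d) G i := h (QuotientGroup.eq.1 hxg)
    simpa using mul_mem hx h2
  rw [h1, ← hS, sup_comm, ← Subgroup.comap_map_eq]
  rfl

lemma kernelT_eq (π : S →ₜ* MaxProP p G) (hπ : Function.Surjective π)
    (hmin : π.toMonoidHom.ker ≤ qCentral (p ^ d) S 2) :
    kernelT p d π = qCentral (p ^ d) S 2 := by
  ext s
  rw [← sup_eq_right.2 hmin, ← quotientMapOfLE_apply_eq_one_iff p d π hπ 2 (proPKernel_le p G d)]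
  rfl

/-- If `R ≤ S^(2)`, then the subgroup `Ker(f)^∨` of `S^[3]` is the image of `R`. -/
lemma mk_mem_imageInQuotient_iff (π : S →ₜ* MaxProP p G) (hπ : Function.Surjective π)
    (hmin : π.toMonoidHom.ker ≤ qCentral (p ^ d) S 2) (s : S) :
    (s : qCentralQuotient (p ^ d) S 3) ∈ imageInQuotient (p ^ d) (kernelT p d π)
      (annihilator (p ^ d) (kernelT p d π) (mapF p d π hπ).ker) (qCentral (p ^ d) S 3) ↔
    s ∈ π.toMonoidHom.ker ⊔ qCentral (p ^ d) S 3 := by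
  have hT := kernelT_eq p d π hπ hmin
  have hq : qCommutator (p ^ d) (kernelT p d π) = qCentral (p ^ d) S 3 := by
    rw [hT]
    rfl
  have hS3 : qCentral (p ^ d) S 3 ≤ kernelT p d π := hT ▸ qCentral_succ_le (p ^ d) 2
  have hR : π.toMonoidHom.ker ≤ kernelT p d π := hT ▸ hmin
  -- Separation requires R S^(3) to be closed; it is the preimage of 1 under S → G^[3].
  have hclosed : IsClosed ((π.toMonoidHom.ker ⊔ qCentral (p ^ d) S 3 : Subgroup S) : Set S) := by
    have e : ((π.toMonoidHom.ker ⊔ qCentral (p ^ d) S 3 : Subgroup S) : Set S) =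
        (fun s => quotientMapOfLE _ _ (proPKernel_le_qCentral d 2) (π s)) ⁻¹' {1} := by
      ext s
      exact (quotientMapOfLE_apply_eq_one_iff p d π hπ 3 (proPKernel_le_qCentral d 2) s).symm
    rw [e]
    exact isClosed_singleton.preimage ((map_continuous _).comp (map_continuous π))
  have hann : ∀ φ : invariantHoms (p ^ d) (kernelT p d π),
      φ ∈ (mapF p d π hπ).ker ↔ ∀ n : kernelT p d π, π n = 1 → φ.1 n = 0 := fun φ =>
    (AddMonoidHom.mem_ker).trans (mapF_eq_zero_iff p d π hπ hmin φ)
  have : NeZero (p ^ d) := ⟨pow_ne_zero d (Fact.out : p.Prime).ne_zero⟩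
  constructor
  · rintro ⟨_, ⟨t, ht, rfl⟩, hts⟩
    have h1 : (t : S) ∈ π.toMonoidHom.ker ⊔ qCentral (p ^ d) S 3 := by
      -- A φ that vanishes on R S^(3) but not at t would lie in Ker(f), yet t annihilates Ker(f).
      by_contra hcon
      obtain ⟨φ, hφ, hφt⟩ := exists_invariantHom_ne_zero (q := p ^ d) (kernelT p d π) _ hclosed
        (hq.le.trans le_sup_right) t hcon
      exact hφt (Multiplicative.ofAdd.injective (ht φ ((hann φ).2 fun n hn =>
        hφ n ((le_sup_left : π.toMonoidHom.ker ≤ _) hn))))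
    have h2 : (t : S)⁻¹ * s ∈ qCentral (p ^ d) S 3 := QuotientGroup.eq.1 hts
    simpa using mul_mem h1 ((le_sup_right : qCentral (p ^ d) S 3 ≤ _) h2)
  · intro hs
    obtain ⟨r, hr, x, hx, rfl⟩ := Subgroup.mem_sup_of_normal_left.1 hs
    refine ⟨r, ⟨⟨r, hR hr⟩, fun φ hφ => ?_, rfl⟩, ?_⟩
    · exact congrArg Multiplicative.ofAdd ((hann φ).1 hφ ⟨r, hR hr⟩ hr)
    · exact (QuotientGroup.mk_mul_of_mem r hx).symm

end Main

theorem proposition7p3 (p : ℕ) [Fact p.Prime] (d : ℕ) (hd : 1 ≤ d)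
    (G : Type u) [Group G] [TopologicalSpace G] [IsTopologicalGroup G] [CompactSpace G]
    [TotallyDisconnectedSpace G]
    (S : Type u) [Group S] [TopologicalSpace S] [IsTopologicalGroup S] [CompactSpace S]
    [TotallyDisconnectedSpace S] (hS : IsFreeProP p S)
    (π : S →ₜ* MaxProP p G) (hπ : Function.Surjective π)
    (hmin : π.toMonoidHom.ker ≤ qCentral (p ^ d) S 2) :
    kernelT p d π = qCentral (p ^ d) S 2 ∧
    Nonempty (qCentralQuotient (p ^ d) G 3 ≃ₜ*
      (qCentralQuotient (p ^ d) S 3 ⧸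
        imageInQuotient (p ^ d) (kernelT p d π)
          (annihilator (p ^ d) (kernelT p d π) (mapF p d π hπ).ker) (qCentral (p ^ d) S 3))) := by
  refine ⟨kernelT_eq p d π hπ hmin, ?_⟩
  set I := imageInQuotient (p ^ d) (kernelT p d π)
    (annihilator (p ^ d) (kernelT p d π) (mapF p d π hπ).ker) (qCentral (p ^ d) S 3)
  let α : S →ₜ* qCentralQuotient (p ^ d) G 3 :=
    (quotientMapOfLE _ _ (proPKernel_le_qCentral d 2)).comp π
  have hα : Function.Surjective α := by
    intro x
    obtain ⟨g, rfl⟩ := QuotientGroup.mk_surjective x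
    obtain ⟨s, hs⟩ := hπ g
    exact ⟨s, congrArg (quotientMapOfLE _ _ (proPKernel_le_qCentral d 2)) hs⟩
  have hker : ∀ s, α s = 1 ↔ (s : qCentralQuotient (p ^ d) S 3) ∈ I := fun s =>
    (quotientMapOfLE_apply_eq_one_iff p d π hπ 3 (proPKernel_le_qCentral d 2) s).trans
      (mk_mem_imageInQuotient_iff p d π hπ hmin s).symm
  let α₁ : qCentralQuotient (p ^ d) S 3 →* qCentralQuotient (p ^ d) G 3 :=
    QuotientGroup.lift _ α.toMonoidHom fun s hs => (hker s).2 (by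
      rw [(QuotientGroup.eq_one_iff s).2 hs]
      exact one_mem I)
  have hα₁ : Continuous α₁ := (map_continuous α).quotient_lift _
  let α₂ : (qCentralQuotient (p ^ d) S 3 ⧸ I) →* qCentralQuotient (p ^ d) G 3 :=
    QuotientGroup.lift I α₁ fun x hx => by
      obtain ⟨s, rfl⟩ := QuotientGroup.mk_surjective x
      exact (hker s).2 hx
  have hα₂ : Continuous α₂ := hα₁.quotient_lift _
  have hbij : Function.Bijective α₂ := by
    constructor
    · rw [injective_iff_map_eq_one]
      intro x hx
      obtain ⟨x, rfl⟩ := QuotientGroup.mk_surjective x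
      obtain ⟨s, rfl⟩ := QuotientGroup.mk_surjective x
      exact (QuotientGroup.eq_one_iff _).2 ((hker s).1 hx)
    · intro x
      obtain ⟨s, rfl⟩ := hα x
      exact ⟨((s : qCentralQuotient (p ^ d) S 3) : _ ⧸ I), rfl⟩
  let e := MulEquiv.ofBijective α₂ hbij
  -- A continuous bijection from a compact space to a Hausdorff space is a homeomorphism.
  exact ⟨(ContinuousMulEquiv.mk e hα₂
    (hα₂.homeoOfEquivCompactToT2 (f := e.toEquiv)).continuous_invFun).symm⟩
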